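/- Let $k$ be a field, $n\ge 1$, $m\ge 0$, and let $D_n\subset\{a_1,b_1,\dots,a_n,b_n\}^*$ be the Dyck language of words balanced in $n$ kinds of parentheses, where $a_i$ is the opening and $b_i$ the closing parenthesis of the $i$-th kind (the empty word included). Let $\phi:\{a_1,b_1,\dots,a_n,b_n\}^*\to\{t_1,\dots,t_m\}^*$ be a monoid homomorphism and $L=\phi(D_n)$. Let $X$ be the set of letters $a_i,b_i,a_i^j,b_i^j,x,e,y,t_k$ ($1\le i,j\le n$, $1\le k\le m$), and let $R\subset k\langle X\rangle$ be the set of the following elements, for all $i,j,l\in\{1,\dots,n\}$: (i) $a_i^i x-xa_i^i$, $\ b_1^1x-xe$; (ii) $a_i^ja_l-a_ia_l^j$, $\ a_i^jb_l-a_ib_l^j$, $\ b_i^ja_l-b_ia_l^j$, $\ b_i^jb_l-b_ib_l^j$, $\ a_i^je-a_ib_j$, $\ b_i^je-b_ib_j$; (iii) $a_iy-y\phi(a_i)$, $\ b_iy-y\phi(b_i)$, $\ a_i^jy$, $\ b_i^jy$; (iv) $xye$. Let $D\ge 1$ be an integer such that all the words $\phi(a_i),\phi(b_i)$ have length at most $D$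 (for instance the maximum of these lengths, if it is not $0$). Give each $t_k$ degree $1$ and every other letter degree $D$, let the degree of a word be the sum of the degrees of its letters, and order $X^*$ by deglex (compare degrees first, then lexicographically from the left) for any total order of $X$ such that $a_\bullet^\bullet>b_\bullet^\bullet>a_\bullet>b_\bullet>e>x>y>t_\bullet$ (the order inside each group of letters is arbitrary). A subset $U$ of a two-sided ideal $I$ of $k\langle X\rangle$ is a Gröbner–Shirshov basis of $I$ if the leading monomials of its nonzero elements generate the monomial ideal generated by the leading monomials of all nonzero elements of $I$. It is minimal if these leading monomials form a minimal generating set of that monomial ideal, $0\notin U$, and distinct elements of $U$ have distinct leading monomials. It is reduced if its elements are monic and no non-leading word of an element of $U$ contains the leading monomial of an element of $U$ as a subword. Then the set $$\{\text{relations (i)--(iii)}\}\ \cup\ xP_nyLe,\qquad P_n=(D_ne)^*,$$ is a minimal Gröbner–Shirshov basis of the two-sided ideal of $k\langle X\rangle$ generated by $R$, and it is reduced. The union is disjoint, and the set of monomials $xP_nyLe$ is infinite. Moreover, $P_n$ consists of the words $e^{i_0}w_1e^{i_1}\cdots w_se^{i_s}$ with $s,i_0\ge 0$, $i_1,\dots,i_s>0$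 and $w_1,\dots,w_s\in D_n$ (the empty word being the case $s=i_0=0$). -/

import Mathlib

noncomputable section

namespace GSDyck

/-! ### Noncommutative Gröbner–Shirshov bases

The free associative algebra `k⟨X⟩` is the monoid algebra of the free monoid `X^*`. -/

section GS

variable {X k : Type*} [Field k]

/-- The free associative algebra `k⟨X⟩`, with basis the words in `X`. -/
abbrev FreeAlg (k X : Type*) [Field k] : Type _ := MonoidAlgebra k (FreeMonoid X)

/-- A word, given as a list of letters, as an element of `k⟨X⟩`. -/
def word (k : Type*) [Field k] (l : List X) : FreeAlg k X :=
  MonoidAlgebra.single (FreeMonoid.ofList l) 1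

/-- `w` is the leading monomial of `f` (which is then nonzero) for the ordering `lt` of words. -/
def IsLeadingMonomial (lt : FreeMonoid X → FreeMonoid X → Prop) (f : FreeAlg k X)
    (w : FreeMonoid X) : Prop :=
  f.coeff w ≠ 0 ∧ ∀ v, f.coeff v ≠ 0 → v ≠ w → lt v w

/-- The set of leading monomials of the nonzero elements of `S`. -/
def leadingMonomials (lt : FreeMonoid X → FreeMonoid X → Prop) (S : Set (FreeAlg k X)) :
    Set (FreeMonoid X) :=
  {w | ∃ f ∈ S, IsLeadingMonomial lt f w}

/-- The two-sided ideal of `k⟨X⟩` generated by a set of words. -/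
def monomialIdeal (k : Type*) [Field k] (W : Set (FreeMonoid X)) : TwoSidedIdeal (FreeAlg k X) :=
  TwoSidedIdeal.span ((fun w => (MonoidAlgebra.single w 1 : FreeAlg k X)) '' W)

/-- The leading monomial ideal of `I`. -/
def leadingIdeal (lt : FreeMonoid X → FreeMonoid X → Prop) (I : TwoSidedIdeal (FreeAlg k X)) :
    TwoSidedIdeal (FreeAlg k X) :=
  monomialIdeal k (leadingMonomials lt (I : Set (FreeAlg k X)))

/-- `U` is a Gröbner–Shirshov basis of `I`: it lies in `I`, and its leading monomials generate
the leading monomial ideal of `I`. -/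
structure IsGSBasis (lt : FreeMonoid X → FreeMonoid X → Prop) (U : Set (FreeAlg k X))
    (I : TwoSidedIdeal (FreeAlg k X)) : Prop where
  subset : U ⊆ (I : Set (FreeAlg k X))
  generates : monomialIdeal k (leadingMonomials lt U) = leadingIdeal lt I

/-- A minimal GS-basis: no element is superfluous, that is, the leading monomials form a minimal
generating set of the leading monomial ideal, and (no repetitions) `0` is not in the basis and
distinct elements have distinct leading monomials. -/
structure IsMinimalGSBasis (lt : FreeMonoid X → FreeMonoid X → Prop) (U : Set (FreeAlg k X))
    (I : TwoSidedIdeal (FreeAlg k X)) : Prop extends IsGSBasis lt U I where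
  minimal : ∀ W, W ⊂ leadingMonomials lt U → monomialIdeal k W ≠ leadingIdeal lt I
  zero_notMem : (0 : FreeAlg k X) ∉ U
  injective : ∀ f ∈ U, ∀ g ∈ U, ∀ w,
    IsLeadingMonomial lt f w → IsLeadingMonomial lt g w → f = g

/-- `U` is reduced: its elements are monic, and no non-leading word of an element of `U` contains
a leading monomial of `U` as a subword. -/
def IsReduced (lt : FreeMonoid X → FreeMonoid X → Prop) (U : Set (FreeAlg k X)) : Prop :=
  ∀ f ∈ U, ∀ w, IsLeadingMonomial lt f w →
    f.coeff w = 1 ∧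
    ∀ v, f.coeff v ≠ 0 → v ≠ w → ∀ u ∈ leadingMonomials lt U, ∀ p q, v ≠ p * u * q

end GS

/-! ### The Dyck language and its homomorphic images -/

/-- The parentheses `a_i` (opening) and `b_i` (closing) of `n` kinds. -/
inductive Paren (n : ℕ) : Type
  | a (i : Fin n)
  | b (i : Fin n)

/-- Balanced words in `n` kinds of parentheses. -/
inductive IsDyck {n : ℕ} : List (Paren n) → Prop
  | nil : IsDyck []
  | cons (i : Fin n) (w w' : List (Paren n)) (hw : IsDyck w) (hw' : IsDyck w') :
      IsDyck (Paren.a i :: w ++ Paren.b i :: w')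

/-- The Dyck language `D_n`. -/
def dyck (n : ℕ) : Language (Paren n) := {w | IsDyck w}

/-- The language `L = φ(D_n)`. -/
def dyckImage {n m : ℕ} (φ : FreeMonoid (Paren n) →* FreeMonoid (Fin m)) : Language (Fin m) :=
  {v | ∃ w ∈ dyck n, (φ (FreeMonoid.ofList w)).toList = v}

/-! ### The algebra -/

/-- The generators: `br (a i)`, `br (b i)` are `a_i`, `b_i`; `up (a i) j`, `up (b i) j` are
`a_i^j`, `b_i^j`; and further `x`, `e`, `y`, `t_k`. -/
inductive Letter (n m : ℕ) : Type
  | br (c : Paren n)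
  | up (c : Paren n) (j : Fin n)
  | x
  | e
  | y
  | t (k : Fin m)

open Letter Paren

/-- Position of the group of a letter in `a_•^• > b_•^• > a_• > b_• > e > x > y > t_•`. -/
def rank {n m : ℕ} : Letter n m → ℕ
  | up (a _) _ => 7
  | up (b _) _ => 6
  | br (a _) => 5
  | br (b _) => 4
  | e => 3
  | x => 2
  | y => 1
  | t _ => 0

/-- The degree of a letter: `1` for the `t_k` and `D` for all other letters. -/
def letterDeg {n m : ℕ} (D : ℕ) : Letter n m → ℕ
  | t _ => 1
  | _ => D

/-- The degree of a word. -/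
def wordDeg {n m : ℕ} (D : ℕ) (w : FreeMonoid (Letter n m)) : ℕ :=
  (w.toList.map (letterDeg D)).sum

/-- The deglex ordering of words: compare degrees first, then lexicographically from the left. -/
def degLex {n m : ℕ} [LinearOrder (Letter n m)] (D : ℕ) (u v : FreeMonoid (Letter n m)) : Prop :=
  wordDeg D u < wordDeg D v ∨ (wordDeg D u = wordDeg D v ∧ List.Lex (· < ·) u.toList v.toList)

section Relations

variable (k : Type*) [Field k] {n m : ℕ}

/-- Relations (i): `a_i^i x - x a_i^i` and `b_1^1 x - x e`. -/
def relI [NeZero n] : Set (FreeAlg k (Letter n m)) :=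
  {f | (∃ i : Fin n, f = word k [up (a i) i, x] - word k [x, up (a i) i]) ∨
    f = word k [up (b 0) 0, x] - word k [x, e]}

/-- Relations (ii): `c^j c' - c c'^j` and `c^j e - c b_j`, where `c`, `c'` run over all the
`a_i`, `b_i`. -/
def relII : Set (FreeAlg k (Letter n m)) :=
  {f | (∃ (c c' : Paren n) (j : Fin n), f = word k [up c j, br c'] - word k [br c, up c' j]) ∨
    ∃ (c : Paren n) (j : Fin n), f = word k [up c j, e] - word k [br c, br (b j)]}

/-- Relations (iii): `c y - y φ(c)` and `c^j y`, where `c` runs over all the `a_i`, `b_i`. -/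
def relIII (φ : FreeMonoid (Paren n) →* FreeMonoid (Fin m)) : Set (FreeAlg k (Letter n m)) :=
  {f | (∃ c : Paren n,
      f = word k [br c, y] - word k (y :: (φ (FreeMonoid.of c)).toList.map t)) ∨
    ∃ (c : Paren n) (j : Fin n), f = word k [up c j, y]}

/-- Relation (iv): `x y e`. -/
def relIV : Set (FreeAlg k (Letter n m)) := {word k [x, y, e]}

end Relations

/-- The language `P_n = (D_n e)^*`. -/
def langP (n m : ℕ) : Language (Letter n m) :=
  KStar.kstar (Language.map br (dyck n) * {[e]})

/-- The words `e^{i_0} w_1 e^{i_1} ⋯ w_s e^{i_s}` with `s, i_0 ≥ 0`, `i_1, …, i_s > 0` and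
`w_1, …, w_s ∈ D_n`; the list `l` consists of the pairs `(w_1, i_1), …, (w_s, i_s)`. -/
def explicitP (n m : ℕ) : Language (Letter n m) :=
  {u | ∃ (i₀ : ℕ) (l : List (List (Paren n) × ℕ)), (∀ q ∈ l, q.1 ∈ dyck n ∧ 0 < q.2) ∧
    u = List.replicate i₀ e ++ l.flatMap (fun q => q.1.map br ++ List.replicate q.2 e)}

/-- The language `x P_n y L e` with `L = φ(D_n)`. -/
def langG {n m : ℕ} (φ : FreeMonoid (Paren n) →* FreeMonoid (Fin m)) : Language (Letter n m) :=
  {[x]} * langP n m * {[y]} * Language.map t (dyckImage φ) * {[e]}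

end GSDyck

end

/-!
Read the relations (i)–(iii) from left to right as rewriting rules and add the rules `u → 0` for
the words `u` of `x P_n y L e`. Deglex decreases along the rules, and no left-hand side occurs in
another left-hand side or in a right-hand side. The only overlaps of left-hand sides are

* `c^j c' y` with parentheses `c` and `c'`,
* `b_1^1 x p y l e` and `a_i^i x p y l e` with `p ∈ P_n` and `l ∈ L`.

All of them rewrite to zero in both ways. For `a_i^i x p y l e` with `p = w e p'` this holds since
`a_i^i w e → a_i w b_i` replaces the Dyck word `w` by the Dyck word `a_i w b_i`; if this leaves a
Dyck word `v` in front of `y`, then `v y → y φ(v)` moves it into `L`. By the composition-diamond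
lemma the rules form a Gröbner–Shirshov basis, which is minimal and reduced because the rules are
interreduced.

The words of `x P_n y L e` lie in the ideal `I` generated by (i)–(iv): if `x v ∈ I`, then
multiplication by `b_1^1` on the left gives `x e v ∈ I`, and if `x w e v ∈ I`, then multiplication
by `a_i^i` gives `x a_i w b_i v ∈ I`. Induction on Dyck words therefore leads from `x y e` to
`x p w y e` for `p ∈ P_n` and `w ∈ D_n`, and `w y → y φ(w)` yields `x p y φ(w) e`.
-/

noncomputable section

namespace GSDyck

section FreeAlgebra

open MonoidAlgebra (of)

variable {X k : Type*} [Field k]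

theorem word_append (l l' : List X) : word k (l ++ l') = word k l * word k l' := by
  simp [word, MonoidAlgebra.single_mul_single]

theorem word_injective : Function.Injective (word k : List X → FreeAlg k X) := fun _ _ h =>
  FreeMonoid.ofList.injective (MonoidAlgebra.of_injective (R := k) (M := FreeMonoid X) h)

theorem coeff_mul_ne_zero {f g : FreeAlg k X} {v : FreeMonoid X} (h : (f * g).coeff v ≠ 0) :
    ∃ p q, f.coeff p ≠ 0 ∧ g.coeff q ≠ 0 ∧ p * q = v := by
  classical
  have hv := MonoidAlgebra.support_coeff_mul_subset f g (Finsupp.mem_support_iff.2 h)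
  simpa only [Finset.mem_mul, Finsupp.mem_support_iff, exists_and_left] using hv

theorem coeff_of_mul_mul_of (p q u : FreeMonoid X) (f : FreeAlg k X) :
    (of k _ p * f * of k _ q).coeff (p * u * q) = f.coeff u := by
  simp

theorem coeff_of_mul_mul_of_ne_zero {p q v : FreeMonoid X} {f : FreeAlg k X}
    (h : (of k _ p * f * of k _ q).coeff v ≠ 0) : ∃ u, f.coeff u ≠ 0 ∧ p * u * q = v := by
  obtain ⟨_, q', hpf, hq, rfl⟩ := coeff_mul_ne_zero h
  obtain ⟨p', u, hp, hu, rfl⟩ := coeff_mul_ne_zero hpf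
  have hp' : p' = p := by
    by_contra hne
    exact hp (by simp [Ne.symm hne])
  have hq' : q' = q := by
    by_contra hne
    exact hq (by simp [Ne.symm hne])
  exact ⟨u, hu, by rw [hp', hq']⟩

theorem mem_span_of_mul_mul_of {S : Set (FreeAlg k X)} {f : FreeAlg k X}
    (hf : f ∈ TwoSidedIdeal.span S) :
    f ∈ Submodule.span k {g | ∃ s ∈ S, ∃ p q, g = of k _ p * s * of k _ q} := by
  have top_eq : (⊤ : Submodule k (FreeAlg k X)) = Submodule.span k (Set.range (of k _)) :=
    (eq_top_iff.2 fun g _ => Submodule.span_mono (Set.image_subset_range _ _)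
      (MonoidAlgebra.mem_span_support_coeff g)).symm
  have top_mul_top : (⊤ : Submodule k (FreeAlg k X)) * ⊤ = ⊤ := eq_top_iff.2 fun g _ => by
    simpa only [mul_one] using
      Submodule.mul_mem_mul (Submodule.mem_top (x := g)) (Submodule.mem_top (x := 1))
  have mem_top_mul_mul_top : f ∈ (⊤ : Submodule k (FreeAlg k X)) * Submodule.span k S * ⊤ := by
    refine TwoSidedIdeal.span_induction
      (p := fun g _ => g ∈ (⊤ : Submodule k (FreeAlg k X)) * Submodule.span k S * ⊤)
      ?_ (zero_mem _) (fun _ _ _ _ => add_mem) (fun _ _ => neg_mem) ?_ ?_ hf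
    · intro s hs
      simpa only [one_mul, mul_one] using Submodule.mul_mem_mul (Submodule.mul_mem_mul
        (Submodule.mem_top (x := 1)) (Submodule.subset_span hs)) (Submodule.mem_top (x := 1))
    · intro h g _ hg
      simpa only [← mul_assoc, top_mul_top] using
        Submodule.mul_mem_mul (Submodule.mem_top (x := h)) hg
    · intro h g _ hg
      simpa only [mul_assoc, top_mul_top] using
        Submodule.mul_mem_mul hg (Submodule.mem_top (x := h))
  rw [top_eq, Submodule.span_mul_span, Submodule.span_mul_span] at mem_top_mul_mul_top
  refine Submodule.span_mono ?_ mem_top_mul_mul_top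
  rintro _ ⟨_, ⟨_, ⟨p, rfl⟩, s, hs, rfl⟩, _, ⟨q, rfl⟩, rfl⟩
  exact ⟨s, hs, p, q, rfl⟩

end FreeAlgebra

section MonomialIdeal

variable {X k : Type*} [Field k] {lt : FreeMonoid X → FreeMonoid X → Prop}
  {U : Set (FreeAlg k X)} {I : TwoSidedIdeal (FreeAlg k X)}

theorem exists_factor_of_mem_monomialIdeal {W : Set (FreeMonoid X)} {f : FreeAlg k X}
    (hf : f ∈ monomialIdeal k W) {v : FreeMonoid X} (hv : f.coeff v ≠ 0) :
    ∃ u ∈ W, ∃ p q, p * u * q = v := by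
  replace hf := mem_span_of_mul_mul_of hf
  induction hf using Submodule.span_induction with
  | mem g hg =>
    obtain ⟨_, ⟨u, hu, rfl⟩, p, q, rfl⟩ := hg
    refine ⟨u, hu, p, q, by_contra fun hne => hv ?_⟩
    simp [MonoidAlgebra.single_mul_single, hne]
  | zero => simp at hv
  | add g h _ _ ihg ihh =>
    by_cases h0 : g.coeff v = 0
    · exact ihh (by simpa [h0] using hv)
    · exact ihg h0
  | smul c g _ ih => exact ih (right_ne_zero_of_mul hv)

theorem single_mem_monomialIdeal {W : Set (FreeMonoid X)} {u : FreeMonoid X} (hu : u ∈ W)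
    (p q : FreeMonoid X) :
    (MonoidAlgebra.single (p * u * q) 1 : FreeAlg k X) ∈ monomialIdeal k W := by
  have h : (MonoidAlgebra.single u 1 : FreeAlg k X) ∈ monomialIdeal k W :=
    TwoSidedIdeal.subset_span ⟨u, hu, rfl⟩
  have := TwoSidedIdeal.mul_mem_right _ _ (MonoidAlgebra.single q 1 : FreeAlg k X)
    (TwoSidedIdeal.mul_mem_left _ (MonoidAlgebra.single p 1 : FreeAlg k X) _ h)
  simpa only [MonoidAlgebra.single_mul_single, one_mul] using this

theorem IsGSBasis.of_exists_factor (hU : U ⊆ (I : Set (FreeAlg k X)))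
    (h : ∀ f ∈ I, ∀ w, IsLeadingMonomial lt f w →
      ∃ u ∈ leadingMonomials lt U, ∃ p q, p * u * q = w) : IsGSBasis lt U I where
  subset := hU
  generates := by
    apply le_antisymm
    · refine TwoSidedIdeal.span_mono (Set.image_mono ?_)
      rintro w ⟨f, hf, hw⟩
      exact ⟨f, hU hf, hw⟩
    · refine TwoSidedIdeal.span_le.2 ?_
      rintro _ ⟨w, ⟨f, hf, hw⟩, rfl⟩
      obtain ⟨u, hu, p, q, rfl⟩ := h f hf w hw
      exact single_mem_monomialIdeal hu p q

theorem IsLeadingMonomial.unique [Std.Asymm lt] {f : FreeAlg k X} {u v : FreeMonoid X}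
    (hu : IsLeadingMonomial lt f u) (hv : IsLeadingMonomial lt f v) : u = v := by
  by_contra hne
  exact asymm (hu.2 v hv.1 (Ne.symm hne)) (hv.2 u hu.1 hne)

theorem IsGSBasis.isMinimalGSBasis [Std.Asymm lt] (hU : IsGSBasis lt U I) (hU₀ : 0 ∉ U)
    (eq_of_factor : ∀ f ∈ U, ∀ g ∈ U, ∀ u p q, IsLeadingMonomial lt f u →
      IsLeadingMonomial lt g (p * u * q) → f = g) : IsMinimalGSBasis lt U I where
  toIsGSBasis := hU
  minimal W hW hWI := by
    obtain ⟨v, ⟨g, hg, hv⟩, hvW⟩ := Set.exists_of_ssubset hW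
    have hmem : (MonoidAlgebra.single v 1 : FreeAlg k X) ∈ monomialIdeal k W := by
      rw [hWI, ← hU.generates]
      exact TwoSidedIdeal.subset_span ⟨v, ⟨g, hg, hv⟩, rfl⟩
    obtain ⟨u, huW, p, q, rfl⟩ := exists_factor_of_mem_monomialIdeal hmem (v := v) (by simp)
    obtain ⟨f, hf, hu⟩ := hW.subset huW
    obtain rfl := eq_of_factor f hf g hg u p q hu hv
    exact hvW (hu.unique hv ▸ huW)
  zero_notMem := hU₀
  injective f hf g hg w hfw hgw :=
    eq_of_factor f hf g hg w 1 1 hfw (by simpa only [one_mul, mul_one] using hgw)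

end MonomialIdeal

section CompositionDiamond

open MonoidAlgebra (of)

variable {X k : Type*} [Field k]

/-- A monomial order on the words: a well-order that is compatible with multiplication. -/
class IsMonomialOrder (lt : FreeMonoid X → FreeMonoid X → Prop) : Prop
    extends IsWellOrder (FreeMonoid X) lt where
  mul_mul (p q : FreeMonoid X) {u v : FreeMonoid X} : lt u v → lt (p * u * q) (p * v * q)

/-- `f` is monic with leading monomial `w`. -/
def IsMonicAt (lt : FreeMonoid X → FreeMonoid X → Prop) (f : FreeAlg k X) (w : FreeMonoid X) :
    Prop :=
  f.coeff w = 1 ∧ ∀ v, f.coeff v ≠ 0 → v ≠ w → lt v w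

/-- `f` is a multiple `p s q` of a monic element `s` of `S` by words `p` and `q`, and `w` is its
leading word, that is, `w = p u q` where `u` is the leading monomial of `s`. -/
def IsMultiple (lt : FreeMonoid X → FreeMonoid X → Prop) (S : Set (FreeAlg k X))
    (f : FreeAlg k X) (w : FreeMonoid X) : Prop :=
  ∃ s ∈ S, ∃ p u q, IsMonicAt lt s u ∧ f = of k _ p * s * of k _ q ∧ w = p * u * q

/-- The subspace spanned by the multiples of elements of `S` with leading word in `A`. For
`A = {v | lt v w}` its elements are said to be trivial modulo `(S, w)`. -/
def multiplesSpan (lt : FreeMonoid X → FreeMonoid X → Prop) (S : Set (FreeAlg k X))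
    (A : Set (FreeMonoid X)) : Submodule k (FreeAlg k X) :=
  Submodule.span k {f | ∃ w ∈ A, IsMultiple lt S f w}

/-- All compositions of elements of `S` are trivial: for an overlap `b` of leading monomials
`a b` and `b c` and for a leading monomial `v` inside a leading monomial `a v c`, the two ways of
cancelling the leading word agree modulo multiples with smaller leading words. -/
structure IsClosedUnderComposition (lt : FreeMonoid X → FreeMonoid X → Prop)
    (S : Set (FreeAlg k X)) : Prop where
  intersection {f g : FreeAlg k X} (hf : f ∈ S) (hg : g ∈ S) {a b c : FreeMonoid X}
    (hfab : IsMonicAt lt f (a * b)) (hgbc : IsMonicAt lt g (b * c)) (hb : b ≠ 1) :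
    f * of k _ c - of k _ a * g ∈ multiplesSpan lt S {v | lt v (a * b * c)}
  inclusion {f g : FreeAlg k X} (hf : f ∈ S) (hg : g ∈ S) {a v c : FreeMonoid X}
    (hfv : IsMonicAt lt f (a * v * c)) (hgv : IsMonicAt lt g v) :
    f - of k _ a * g * of k _ c ∈ multiplesSpan lt S {u | lt u (a * v * c)}

variable {lt : FreeMonoid X → FreeMonoid X → Prop} {S : Set (FreeAlg k X)}

theorem IsMonicAt.isLeadingMonomial {f : FreeAlg k X} {w : FreeMonoid X} (h : IsMonicAt lt f w) :
    IsLeadingMonomial lt f w :=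
  ⟨by simp [h.1], h.2⟩

theorem IsMonicAt.sub_of_mem_span {f : FreeAlg k X} {w : FreeMonoid X} (h : IsMonicAt lt f w) :
    f - of k _ w ∈ Submodule.span k (of k _ '' {v | lt v w}) := by
  refine Submodule.span_mono (Set.image_mono fun v hv => ?_)
    (MonoidAlgebra.mem_span_support_coeff _)
  have hv' : (f - of k _ w).coeff v ≠ 0 := Finsupp.mem_support_iff.1 hv
  rcases eq_or_ne v w with rfl | hvw
  · simp [h.1] at hv'
  · exact h.2 v (by simpa [hvw.symm] using hv') hvw

theorem multiplesSpan_mono {A B : Set (FreeMonoid X)} (hAB : A ⊆ B) :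
    multiplesSpan lt S A ≤ multiplesSpan lt S B :=
  Submodule.span_mono fun _ ⟨w, hw, hf⟩ => ⟨w, hAB hw, hf⟩

theorem mem_multiplesSpan_of_mem_span (hS : ∀ s ∈ S, ∃ u, IsMonicAt lt s u) {f : FreeAlg k X}
    (hf : f ∈ TwoSidedIdeal.span S) : f ∈ multiplesSpan lt S Set.univ := by
  refine Submodule.span_mono ?_ (mem_span_of_mul_mul_of hf)
  rintro _ ⟨s, hs, p, q, rfl⟩
  obtain ⟨u, hu⟩ := hS s hs
  exact ⟨_, Set.mem_univ _, s, hs, p, u, q, hu, rfl, rfl⟩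

theorem of_mul_mul_of_mem_multiplesSpan {A B : Set (FreeMonoid X)} {p q : FreeMonoid X}
    (hAB : ∀ w ∈ A, p * w * q ∈ B) {f : FreeAlg k X} (hf : f ∈ multiplesSpan lt S A) :
    of k _ p * f * of k _ q ∈ multiplesSpan lt S B := by
  suffices multiplesSpan lt S A ≤ (multiplesSpan lt S B).comap
      (LinearMap.mulRight k (of k _ q) ∘ₗ LinearMap.mulLeft k (of k _ p)) by
    simpa only [Submodule.mem_comap, LinearMap.comp_apply, LinearMap.mulLeft_apply,
      LinearMap.mulRight_apply] using this hf
  refine Submodule.span_le.2 ?_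
  rintro _ ⟨w, hw, s, hs, p', u, q', hu, rfl, rfl⟩
  simp only [SetLike.mem_coe, Submodule.mem_comap, LinearMap.comp_apply, LinearMap.mulLeft_apply,
    LinearMap.mulRight_apply]
  refine Submodule.subset_span ⟨_, hAB _ hw, s, hs, p * p', u, q' * q, hu, ?_, ?_⟩
  · simp only [map_mul, mul_assoc]
  · simp only [mul_assoc]

theorem exists_of_mul_eq_mul {a b c d : FreeMonoid X} (h : a * b = c * d) :
    (∃ r, c = a * r ∧ b = r * d) ∨ ∃ r, a = c * r ∧ d = r * b :=
  List.append_eq_append_iff.1 h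

variable [IsMonomialOrder lt]

theorem IsMonicAt.of_mul_mul_of {f : FreeAlg k X} {w : FreeMonoid X} (h : IsMonicAt lt f w)
    (p q : FreeMonoid X) : IsMonicAt lt (of k _ p * f * of k _ q) (p * w * q) := by
  refine ⟨by rw [coeff_of_mul_mul_of, h.1], fun v hv hvw => ?_⟩
  obtain ⟨u, hu, rfl⟩ := coeff_of_mul_mul_of_ne_zero hv
  exact IsMonomialOrder.mul_mul p q (h.2 u hu (by rintro rfl; exact hvw rfl))

theorem IsMultiple.isMonicAt {f : FreeAlg k X} {w : FreeMonoid X} (h : IsMultiple lt S f w) :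
    IsMonicAt lt f w := by
  obtain ⟨s, -, p, u, q, hu, rfl, rfl⟩ := h
  exact hu.of_mul_mul_of p q

theorem lt_of_mem_multiplesSpan {w : FreeMonoid X} {f : FreeAlg k X}
    (hf : f ∈ multiplesSpan lt S {v | lt v w}) {v : FreeMonoid X} (hv : f.coeff v ≠ 0) :
    lt v w := by
  induction hf using Submodule.span_induction with
  | mem g hg =>
    obtain ⟨u, hu, hg⟩ := hg
    rcases eq_or_ne v u with rfl | hne
    · exact hu
    · exact trans_of lt (hg.isMonicAt.2 v hv hne) hu
  | zero => simp at hv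
  | add g h _ _ ihg ihh =>
    by_cases h0 : g.coeff v = 0
    · exact ihh (by simpa [h0] using hv)
    · exact ihg h0
  | smul c g _ ih => exact ih (right_ne_zero_of_mul hv)

theorem of_mul_mul_mem_multiplesSpan {f : FreeAlg k X} (hf : f ∈ S) {p u v : FreeMonoid X}
    (hu : IsMonicAt lt f u) {g : FreeAlg k X}
    (hg : g ∈ Submodule.span k (of k _ '' {w | lt w v})) :
    f * of k _ p * g ∈ multiplesSpan lt S {w | lt w (u * p * v)} := by
  suffices Submodule.span k (of k _ '' {w | lt w v}) ≤
      (multiplesSpan lt S {w | lt w (u * p * v)}).comap (LinearMap.mulLeft k (f * of k _ p))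
    by simpa only [Submodule.mem_comap, LinearMap.mulLeft_apply] using this hg
  refine Submodule.span_le.2 ?_
  rintro _ ⟨w, hw, rfl⟩
  refine Submodule.subset_span ⟨u * (p * w), ?_, f, hf, 1, u, p * w, hu, ?_, by simp⟩
  · simpa [mul_assoc] using IsMonomialOrder.mul_mul (u * p) 1 hw
  · simp only [map_one, one_mul, map_mul, mul_assoc, LinearMap.mulLeft_apply]

theorem mul_of_mul_mem_multiplesSpan {g : FreeAlg k X} (hg : g ∈ S) {p u v : FreeMonoid X}
    (hv : IsMonicAt lt g v) {f : FreeAlg k X}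
    (hf : f ∈ Submodule.span k (of k _ '' {w | lt w u})) :
    f * of k _ p * g ∈ multiplesSpan lt S {w | lt w (u * p * v)} := by
  suffices Submodule.span k (of k _ '' {w | lt w u}) ≤
      (multiplesSpan lt S {w | lt w (u * p * v)}).comap (LinearMap.mulRight k (of k _ p * g))
    by simpa only [mul_assoc, Submodule.mem_comap, LinearMap.mulRight_apply] using this hf
  refine Submodule.span_le.2 ?_
  rintro _ ⟨w, hw, rfl⟩
  refine Submodule.subset_span ⟨w * p * v, ?_, g, hg, w * p, v, 1, hv, ?_, by simp⟩
  · simpa [mul_assoc] using IsMonomialOrder.mul_mul 1 (p * v) hw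
  · simp only [map_one, mul_one, map_mul, mul_assoc, LinearMap.mulRight_apply]

theorem mul_of_sub_of_mul_mem_multiplesSpan {f g : FreeAlg k X} (hf : f ∈ S) (hg : g ∈ S)
    {u v : FreeMonoid X} (hu : IsMonicAt lt f u) (hv : IsMonicAt lt g v) (p : FreeMonoid X) :
    f * of k _ (p * v) - of k _ (u * p) * g ∈ multiplesSpan lt S {w | lt w (u * p * v)} := by
  have hsplit : f * of k _ (p * v) - of k _ (u * p) * g =
      (f - of k _ u) * of k _ p * g - f * of k _ p * (g - of k _ v) := by
    rw [map_mul, map_mul]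
    noncomm_ring
  rw [hsplit]
  exact sub_mem (mul_of_mul_mem_multiplesSpan hg hv hu.sub_of_mem_span)
    (of_mul_mul_mem_multiplesSpan hf hu hv.sub_of_mem_span)

theorem IsClosedUnderComposition.mul_of_sub_mem (hS : IsClosedUnderComposition lt S)
    {f g : FreeAlg k X} (hf : f ∈ S) (hg : g ∈ S) {u v : FreeMonoid X} (hu : IsMonicAt lt f u)
    (hv : IsMonicAt lt g v) {q r q' : FreeMonoid X} (h : u * q = r * (v * q')) :
    f * of k _ q - of k _ r * g * of k _ q' ∈ multiplesSpan lt S {w | lt w (u * q)} := by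
  have mul_of {h : FreeAlg k X} {w : FreeMonoid X} (s : FreeMonoid X)
      (hh : h ∈ multiplesSpan lt S {v | lt v w}) :
      h * of k _ s ∈ multiplesSpan lt S {v | lt v (w * s)} := by
    simpa only [map_one, one_mul] using of_mul_mul_of_mem_multiplesSpan (p := 1)
      (B := {v | lt v (w * s)})
      (fun v hv => IsMonomialOrder.mul_mul 1 s hv) hh
  rcases exists_of_mul_eq_mul h with ⟨s, rfl, rfl⟩ | ⟨s, rfl, hs⟩
  · simpa only [sub_mul, map_mul, mul_assoc] using
      mul_of q' (mul_of_sub_of_mul_mem_multiplesSpan hf hg hu hv s)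
  rcases exists_of_mul_eq_mul hs with ⟨d, rfl, rfl⟩ | ⟨d, rfl, rfl⟩
  · rw [← mul_assoc] at hu
    simpa only [sub_mul, map_mul, mul_assoc] using mul_of q (hS.inclusion hf hg hu hv)
  rcases eq_or_ne s 1 with rfl | hs1
  · rw [mul_one] at hu
    rw [one_mul] at hv
    simpa only [sub_mul, map_mul, mul_assoc, one_mul, mul_one, map_one] using
      mul_of q' (mul_of_sub_of_mul_mem_multiplesSpan hf hg hu hv 1)
  · simpa only [sub_mul, map_mul, mul_assoc] using mul_of q' (hS.intersection hf hg hu hv hs1)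

theorem IsMultiple.sub_mem (hS : IsClosedUnderComposition lt S) {f g : FreeAlg k X}
    {w : FreeMonoid X} (hf : IsMultiple lt S f w) (hg : IsMultiple lt S g w) :
    f - g ∈ multiplesSpan lt S {v | lt v w} := by
  have of_eq_mul {f g : FreeAlg k X} (hf : f ∈ S) (hg : g ∈ S) {u v : FreeMonoid X}
      (hu : IsMonicAt lt f u) (hv : IsMonicAt lt g v) (p q q' r : FreeMonoid X)
      (h : u * q = r * (v * q')) :
      of k _ p * f * of k _ q - of k _ (p * r) * g * of k _ q' ∈
        multiplesSpan lt S {w | lt w (p * u * q)} := by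
    have := of_mul_mul_of_mem_multiplesSpan (p := p) (q := 1)
      (B := {w | lt w (p * (u * q) * 1)}) (fun w hw => IsMonomialOrder.mul_mul p 1 hw)
      (hS.mul_of_sub_mem hf hg hu hv h)
    simpa only [map_one, mul_one, mul_sub, map_mul, mul_assoc] using this
  obtain ⟨f, hf, p, u, q, hu, rfl, rfl⟩ := hf
  obtain ⟨g, hg, p', v, q', hv, rfl, hw⟩ := hg
  rw [mul_assoc, mul_assoc] at hw
  rcases exists_of_mul_eq_mul hw with ⟨r, rfl, h⟩ | ⟨r, rfl, h⟩
  · exact of_eq_mul hf hg hu hv p q q' r h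
  · rw [mul_assoc, hw, ← mul_assoc, ← neg_sub]
    exact neg_mem (of_eq_mul hg hf hv hu p' q' q r h)

theorem exists_multiple_of_mem_multiplesSpan (hS : IsClosedUnderComposition lt S)
    {A : Set (FreeMonoid X)} {f : FreeAlg k X} (hf : f ∈ multiplesSpan lt S A) :
    f = 0 ∨ ∃ w ∈ A, ∃ g, IsMultiple lt S g w ∧ ∃ c : k,
      f - c • g ∈ multiplesSpan lt S {v | lt v w} := by
  have add_of_lt {f f' g g' : FreeAlg k X} {c c' : k} {w w' : FreeMonoid X}
      (hg : IsMultiple lt S g w) (hf : f - c • g ∈ multiplesSpan lt S {v | lt v w})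
      (hf' : f' - c' • g' ∈ multiplesSpan lt S {v | lt v w'}) (hw : lt w w') :
      f + f' - c' • g' ∈ multiplesSpan lt S {v | lt v w'} := by
    have hcg : c • g ∈ multiplesSpan lt S {v | lt v w'} :=
      Submodule.smul_mem _ c (Submodule.subset_span ⟨w, hw, hg⟩)
    have hlt : {v | lt v w} ⊆ {v | lt v w'} := fun v hv => trans_of lt hv hw
    have := add_mem (add_mem (multiplesSpan_mono hlt hf) hcg) hf'
    simpa only [sub_add_cancel, ← add_sub_assoc] using this
  induction hf using Submodule.span_induction with
  | mem g hg =>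
    obtain ⟨w, hw, hg⟩ := hg
    exact Or.inr ⟨w, hw, g, hg, 1, by simp⟩
  | zero => exact Or.inl rfl
  | smul a f _ ih =>
    rcases ih with rfl | ⟨w, hw, g, hg, c, hf⟩
    · exact Or.inl (smul_zero a)
    · refine Or.inr ⟨w, hw, g, hg, a * c, ?_⟩
      simpa only [smul_sub, mul_smul] using Submodule.smul_mem _ a hf
  | add f f' _ _ ih ih' =>
    rcases ih with rfl | ⟨w, hw, g, hg, c, hf⟩
    · simpa only [zero_add] using ih'
    rcases ih' with rfl | ⟨w', hw', g', hg', c', hf'⟩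
    · exact Or.inr ⟨w, hw, g, hg, c, by simpa only [add_zero] using hf⟩
    right
    rcases trichotomous_of lt w w' with hlt | rfl | hlt
    · exact ⟨w', hw', g', hg', c', add_of_lt hg hf hf' hlt⟩
    · refine ⟨w, hw, g, hg, c + c', ?_⟩
      have : f + f' - (c + c') • g = f - c • g + (f' - c' • g') + c' • (g' - g) := by module
      rw [this]
      exact add_mem (add_mem hf hf') (Submodule.smul_mem _ c' (hg'.sub_mem hS hg))
    · exact ⟨w, hw, g, hg, c, by rw [add_comm]; exact add_of_lt hg' hf' hf hlt⟩

theorem exists_isLeadingMonomial_of_mem_multiplesSpan (hS : IsClosedUnderComposition lt S)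
    {A : Set (FreeMonoid X)} {f : FreeAlg k X} (hf : f ∈ multiplesSpan lt S A) (hf₀ : f ≠ 0) :
    ∃ w g, IsMultiple lt S g w ∧ IsLeadingMonomial lt f w := by
  have of_sub_mem (w : FreeMonoid X) : ∀ (g : FreeAlg k X) (c : k), IsMultiple lt S g w →
      f - c • g ∈ multiplesSpan lt S {v | lt v w} →
        ∃ w g, IsMultiple lt S g w ∧ IsLeadingMonomial lt f w := by
    induction w using IsWellFounded.induction lt with
    | ind w ih =>
      intro g c hg hfg
      rcases eq_or_ne c 0 with rfl | hc
      · rw [zero_smul, sub_zero] at hfg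
        obtain ⟨v, hv, g', hg', c', hf'⟩ :=
          (exists_multiple_of_mem_multiplesSpan hS hfg).resolve_left hf₀
        exact ih v hv g' c' hg' hf'
      refine ⟨w, g, hg, fun hfw => ?_, fun v hv hvw => ?_⟩
      · have hw : (f - c • g).coeff w ≠ 0 := by simp [hfw, hg.isMonicAt.1, hc]
        exact irrefl_of lt w (lt_of_mem_multiplesSpan hfg hw)
      · by_cases hgv : g.coeff v = 0
        · exact lt_of_mem_multiplesSpan hfg (by simpa [hgv] using hv)
        · exact hg.isMonicAt.2 v hgv hvw
  obtain ⟨w, -, g, hg, c, hfg⟩ := (exists_multiple_of_mem_multiplesSpan hS hf).resolve_left hf₀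
  exact of_sub_mem w g c hg hfg

theorem IsClosedUnderComposition.isGSBasis (hS : IsClosedUnderComposition lt S)
    (hmonic : ∀ s ∈ S, ∃ u, IsMonicAt lt s u) : IsGSBasis lt S (TwoSidedIdeal.span S) := by
  refine IsGSBasis.of_exists_factor TwoSidedIdeal.subset_span fun f hf w hw => ?_
  have hf₀ : f ≠ 0 := by
    rintro rfl
    exact hw.1 (by simp)
  obtain ⟨v, g, ⟨s, hs, p, u, q, hu, -, rfl⟩, hv⟩ :=
    exists_isLeadingMonomial_of_mem_multiplesSpan hS (mem_multiplesSpan_of_mem_span hmonic hf) hf₀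
  exact ⟨u, ⟨s, hs, hu.isLeadingMonomial⟩, p, q, hv.unique hw⟩

end CompositionDiamond

section ReductionSystem

variable {X k : Type*} [Field k]

/-- A word as an element of `k⟨X⟩`, and `0` for `none`. -/
def wordOrZero (k : Type*) [Field k] (o : Option (List X)) : FreeAlg k X :=
  o.elim 0 (word k)

/-- A set `ρ` of rewriting rules `l → r` with `r` a word (`ρ l (some r)`) or zero (`ρ l none`),
viewed as the set of elements `l - r` of `k⟨X⟩`. -/
def binomials (k : Type*) [Field k] (ρ : List X → Option (List X) → Prop) : Set (FreeAlg k X) :=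
  {f | ∃ l o, ρ l o ∧ f = word k l - wordOrZero k o}

/-- Application of one rule of `ρ` to a subword of a word; `none` stands for zero. -/
inductive Step (ρ : List X → Option (List X) → Prop) : Option (List X) → Option (List X) → Prop
  | of_rule {l : List X} {o : Option (List X)} (h : ρ l o) (p q : List X) :
      Step ρ (some (p ++ l ++ q)) (o.map fun r => p ++ r ++ q)

/-- Reduction of words, or zero, by the rules of `ρ`. -/
abbrev Reduces (ρ : List X → Option (List X) → Prop) : Option (List X) → Option (List X) → Prop :=
  Relation.ReflTransGen (Step ρ)

/-- Whenever left-hand sides `a b` and `b c` of rules of `ρ` overlap in `b`, both results of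
rewriting `a b c` reduce to a common word or both to zero. -/
def HasJoinableOverlaps (ρ : List X → Option (List X) → Prop) : Prop :=
  ∀ ⦃a b c : List X⦄ ⦃o o' : Option (List X)⦄, a ≠ [] → b ≠ [] → c ≠ [] →
    ρ (a ++ b) o → ρ (b ++ c) o' →
      Relation.Join (Reduces ρ) (o.map (· ++ c)) (o'.map (a ++ ·))

/-- The rules of `ρ` decrease words, and no left-hand side of a rule occurs in the left-hand side
of another rule or in a right-hand side. -/
structure IsInterreduced (lt : FreeMonoid X → FreeMonoid X → Prop)
    (ρ : List X → Option (List X) → Prop) : Prop where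
  lt_of_rule {l r : List X} : ρ l (some r) → lt (FreeMonoid.ofList r) (FreeMonoid.ofList l)
  eq_of_infix {l l' : List X} {o o' : Option (List X)} :
    ρ l o → ρ l' o' → l <:+: l' → l = l' ∧ o = o'
  not_infix {l l' r : List X} {o : Option (List X)} : ρ l o → ρ l' (some r) → ¬ l <:+: r

variable {ρ : List X → Option (List X) → Prop} {lt : FreeMonoid X → FreeMonoid X → Prop}

theorem coeff_wordOrZero_ne_zero {o : Option (List X)} {v : FreeMonoid X}
    (h : (wordOrZero k o).coeff v ≠ 0) : o = some v.toList := by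
  cases o with
  | none => simp [wordOrZero] at h
  | some r =>
    by_contra hne
    have hrv : FreeMonoid.ofList r ≠ v := by
      rintro rfl
      exact hne rfl
    simp [wordOrZero, word, hrv] at h

theorem word_mul_wordOrZero_mul_word (p q : List X) (o : Option (List X)) :
    word k p * wordOrZero k o * word k q = wordOrZero k (o.map fun r => p ++ r ++ q) := by
  cases o <;> simp [wordOrZero, word_append, mul_assoc]

theorem word_mul_sub_mul_word (p l q : List X) (o : Option (List X)) :
    word k p * (word k l - wordOrZero k o) * word k q =
      wordOrZero k (some (p ++ l ++ q)) - wordOrZero k (o.map fun r => p ++ r ++ q) := by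
  rw [mul_sub, sub_mul, word_mul_wordOrZero_mul_word, ← word_append, ← word_append]
  rfl

theorem Reduces.map_append {o o' : Option (List X)} (h : Reduces ρ o o') (p q : List X) :
    Reduces ρ (o.map fun r => p ++ r ++ q) (o'.map fun r => p ++ r ++ q) := by
  refine Relation.ReflTransGen.lift (Option.map fun r => p ++ r ++ q) ?_ _ _ h
  rintro _ _ ⟨hρ, p', q'⟩
  simpa [Function.onFun, Function.comp_def] using Step.of_rule hρ (p ++ p') (q' ++ q)

theorem Reduces.of_rule {l : List X} {o : Option (List X)} (h : ρ l o) (p q : List X) :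
    Reduces ρ (some (p ++ l ++ q)) (o.map fun r => p ++ r ++ q) :=
  .single (.of_rule h p q)

theorem Reduces.wordOrZero_sub_mem {I : TwoSidedIdeal (FreeAlg k X)}
    (hI : binomials k ρ ⊆ (I : Set (FreeAlg k X))) {o o' : Option (List X)}
    (h : Reduces ρ o o') : wordOrZero k o - wordOrZero k o' ∈ I := by
  induction h with
  | refl => simpa only [sub_self] using I.zero_mem
  | tail _ hstep ih =>
    obtain @⟨l, o, hρ, p, q⟩ := hstep
    have hlo := I.mul_mem_right _ (word k q) (I.mul_mem_left (word k p) _ (hI ⟨l, o, hρ, rfl⟩))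
    rw [word_mul_sub_mul_word] at hlo
    simpa only [sub_add_sub_cancel] using I.add_mem ih hlo

theorem Reduces.word_mem_iff {I : TwoSidedIdeal (FreeAlg k X)}
    (hI : binomials k ρ ⊆ (I : Set (FreeAlg k X))) {u v : List X}
    (h : Reduces ρ (some u) (some v)) : word k u ∈ I ↔ word k v ∈ I := by
  have hsub : word k u - word k v ∈ I := h.wordOrZero_sub_mem hI
  exact ⟨fun hu => sub_sub_cancel (word k u) (word k v) ▸ I.sub_mem hu hsub,
    fun hv => sub_add_cancel (word k u) (word k v) ▸ I.add_mem hsub hv⟩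

theorem IsInterreduced.isMonicAt [Std.Irrefl lt] (hρ : IsInterreduced lt ρ) {l : List X}
    {o : Option (List X)} (h : ρ l o) :
    IsMonicAt lt (word k l - wordOrZero k o) (FreeMonoid.ofList l) := by
  have hl : (wordOrZero k o).coeff (FreeMonoid.ofList l) = 0 := by
    by_contra hne
    obtain rfl := coeff_wordOrZero_ne_zero hne
    exact irrefl_of lt _ (hρ.lt_of_rule h)
  refine ⟨by simp [word, hl], fun v hv hvl => ?_⟩
  have hlv : (word k l).coeff v = 0 := by simp [word, hvl.symm]
  obtain rfl := coeff_wordOrZero_ne_zero (o := o) (v := v) (k := k) (by simpa [hlv] using hv)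
  exact hρ.lt_of_rule h

theorem IsInterreduced.isLeadingMonomial_iff [Std.Asymm lt] (hρ : IsInterreduced lt ρ)
    {l : List X} {o : Option (List X)} (h : ρ l o) {w : FreeMonoid X} :
    IsLeadingMonomial lt (word k l - wordOrZero k o) w ↔ w = FreeMonoid.ofList l :=
  ⟨fun hw => hw.unique (hρ.isMonicAt h).isLeadingMonomial,
    fun hw => hw ▸ (hρ.isMonicAt h).isLeadingMonomial⟩

theorem infix_of_ofList_eq_mul {u v : List X} {p q : FreeMonoid X}
    (h : FreeMonoid.ofList v = p * FreeMonoid.ofList u * q) : u <:+: v :=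
  ⟨p.toList, q.toList, (congrArg FreeMonoid.toList h).symm⟩

theorem IsInterreduced.isReduced [Std.Asymm lt] (hρ : IsInterreduced lt ρ) :
    IsReduced lt (binomials k ρ) := by
  rintro _ ⟨l, o, hlo, rfl⟩ w hw
  rw [(hρ.isLeadingMonomial_iff hlo).1 hw]
  refine ⟨(hρ.isMonicAt hlo).1, ?_⟩
  rintro v hv hvl u ⟨_, ⟨l', o', hlo', rfl⟩, hu⟩ p q hvu
  rw [(hρ.isLeadingMonomial_iff hlo').1 hu] at hvu
  have hlv : (word k l).coeff v = 0 := by simp [word, hvl.symm]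
  obtain rfl := coeff_wordOrZero_ne_zero (o := o) (v := v) (k := k) (by simpa [hlv] using hv)
  exact hρ.not_infix hlo' hlo (infix_of_ofList_eq_mul hvu)

variable [IsMonomialOrder lt]

theorem IsInterreduced.lt_of_reduces (hρ : IsInterreduced lt ρ) {w : FreeMonoid X}
    {o o' : Option (List X)} (h : Reduces ρ o o')
    (ho : ∀ u ∈ o, lt (FreeMonoid.ofList u) w) : ∀ u ∈ o', lt (FreeMonoid.ofList u) w := by
  induction h with
  | refl => exact ho
  | tail _ hstep ih =>
    obtain @⟨l, o, hlo, p, q⟩ := hstep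
    intro u hu
    obtain ⟨r, rfl, rfl⟩ := Option.map_eq_some_iff.1 hu
    refine trans_of lt ?_ (ih _ rfl)
    exact IsMonomialOrder.mul_mul (FreeMonoid.ofList p) (FreeMonoid.ofList q) (hρ.lt_of_rule hlo)

theorem IsInterreduced.wordOrZero_sub_mem_multiplesSpan (hρ : IsInterreduced lt ρ)
    {w : FreeMonoid X} {o o' : Option (List X)} (h : Reduces ρ o o')
    (ho : ∀ u ∈ o, lt (FreeMonoid.ofList u) w) :
    wordOrZero k o - wordOrZero k o' ∈ multiplesSpan lt (binomials k ρ) {v | lt v w} := by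
  induction h with
  | refl => simpa only [sub_self] using zero_mem _
  | tail hred hstep ih =>
    have hlt := hρ.lt_of_reduces hred ho
    obtain @⟨l, o, hlo, p, q⟩ := hstep
    have hmem : word k p * (word k l - wordOrZero k o) * word k q ∈
        multiplesSpan lt (binomials k ρ) {v | lt v w} :=
      Submodule.subset_span ⟨_, hlt _ rfl, _, ⟨l, o, hlo, rfl⟩, FreeMonoid.ofList p,
        FreeMonoid.ofList l, FreeMonoid.ofList q, hρ.isMonicAt hlo, rfl, rfl⟩
    rw [word_mul_sub_mul_word] at hmem
    simpa only [sub_add_sub_cancel] using add_mem ih hmem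

theorem IsInterreduced.overlap_sub_mem_multiplesSpan (hρ : IsInterreduced lt ρ)
    {a b c : List X} {o o' : Option (List X)} (hab : ρ (a ++ b) o) (hbc : ρ (b ++ c) o')
    (hjoin : Relation.Join (Reduces ρ) (o.map (· ++ c)) (o'.map (a ++ ·))) :
    (word k (a ++ b) - wordOrZero k o) * word k c - word k a * (word k (b ++ c) - wordOrZero k o') ∈
      multiplesSpan lt (binomials k ρ) {v | lt v (FreeMonoid.ofList (a ++ b ++ c))} := by
  obtain ⟨o'', ho, ho'⟩ := hjoin
  have hsub : (word k (a ++ b) - wordOrZero k o) * word k c -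
      word k a * (word k (b ++ c) - wordOrZero k o') =
        (wordOrZero k (o'.map (a ++ ·)) - wordOrZero k o'') -
          (wordOrZero k (o.map (· ++ c)) - wordOrZero k o'') := by
    have hc : wordOrZero k o * word k c = wordOrZero k (o.map (· ++ c)) := by
      cases o <;> simp [wordOrZero, word_append]
    have ha : word k a * wordOrZero k o' = wordOrZero k (o'.map (a ++ ·)) := by
      cases o' <;> simp [wordOrZero, word_append]
    rw [sub_mul, mul_sub, hc, ha, word_append, word_append]
    noncomm_ring
  rw [hsub]
  refine sub_mem (hρ.wordOrZero_sub_mem_multiplesSpan ho' ?_)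
    (hρ.wordOrZero_sub_mem_multiplesSpan ho ?_)
  · intro u hu
    obtain ⟨r, rfl, rfl⟩ := Option.map_eq_some_iff.1 hu
    simpa [mul_assoc] using IsMonomialOrder.mul_mul (FreeMonoid.ofList a) 1 (hρ.lt_of_rule hbc)
  · intro u hu
    obtain ⟨r, rfl, rfl⟩ := Option.map_eq_some_iff.1 hu
    simpa [mul_assoc] using IsMonomialOrder.mul_mul 1 (FreeMonoid.ofList c) (hρ.lt_of_rule hab)

theorem IsInterreduced.isClosedUnderComposition (hρ : IsInterreduced lt ρ)
    (joinable : HasJoinableOverlaps ρ) :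
    IsClosedUnderComposition lt (binomials k ρ) where
  inclusion := by
    rintro _ _ ⟨l, o, hlo, rfl⟩ ⟨l', o', hlo', rfl⟩ a v c hf hg
    have hv := (hρ.isLeadingMonomial_iff hlo').1 hg.isLeadingMonomial
    have hl := ((hρ.isLeadingMonomial_iff hlo).1 hf.isLeadingMonomial).symm
    rw [hv] at hl
    obtain ⟨rfl, rfl⟩ := hρ.eq_of_infix hlo' hlo (infix_of_ofList_eq_mul hl)
    obtain ⟨ha, hc⟩ : a = 1 ∧ c = 1 := by
      have := congrArg FreeMonoid.length hl
      simp only [FreeMonoid.length_mul] at this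
      exact ⟨FreeMonoid.length_eq_zero.1 (by omega), FreeMonoid.length_eq_zero.1 (by omega)⟩
    simpa only [ha, hc, map_one, one_mul, mul_one, sub_self] using zero_mem _
  intersection := by
    rintro _ _ ⟨l, o, hlo, rfl⟩ ⟨l', o', hlo', rfl⟩ a b c hf hg hb
    obtain rfl : a.toList ++ b.toList = l := (hρ.isLeadingMonomial_iff hlo).1 hf.isLeadingMonomial
    obtain rfl : b.toList ++ c.toList = l' :=
      (hρ.isLeadingMonomial_iff hlo').1 hg.isLeadingMonomial
    have hjoin : Relation.Join (Reduces ρ) (o.map (· ++ c.toList))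
        (o'.map (a.toList ++ ·)) := by
      rcases eq_or_ne a 1 with rfl | ha
      · obtain ⟨hbc, rfl⟩ := hρ.eq_of_infix hlo hlo' ⟨[], c.toList, rfl⟩
        obtain rfl : c = 1 := List.self_eq_append_right.1 hbc
        exact ⟨o, by simp [Relation.ReflTransGen.refl], by simp [Relation.ReflTransGen.refl]⟩
      rcases eq_or_ne c 1 with rfl | hc
      · obtain ⟨hab, rfl⟩ := hρ.eq_of_infix hlo' hlo ⟨a.toList, [], by simp⟩
        obtain rfl : a = 1 := List.append_left_eq_self.1 (hab.symm.trans (List.append_nil _))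
        exact ⟨o', by simp [Relation.ReflTransGen.refl], by simp [Relation.ReflTransGen.refl]⟩
      exact joinable ha hb hc hlo hlo'
    exact hρ.overlap_sub_mem_multiplesSpan hlo hlo' hjoin

theorem IsInterreduced.isMinimalGSBasis (hρ : IsInterreduced lt ρ)
    (joinable : HasJoinableOverlaps ρ) :
    IsMinimalGSBasis lt (binomials k ρ) (TwoSidedIdeal.span (binomials k ρ)) := by
  have hmonic : ∀ f ∈ binomials k ρ, ∃ u, IsMonicAt lt f u := by
    rintro _ ⟨l, o, hlo, rfl⟩
    exact ⟨_, hρ.isMonicAt hlo⟩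
  refine ((hρ.isClosedUnderComposition joinable).isGSBasis hmonic).isMinimalGSBasis ?_ ?_
  · intro h₀
    obtain ⟨u, hu⟩ := hmonic 0 h₀
    exact hu.isLeadingMonomial.1 (by simp)
  · rintro _ ⟨l, o, hlo, rfl⟩ _ ⟨l', o', hlo', rfl⟩ u p q hu hpuq
    obtain rfl := (hρ.isLeadingMonomial_iff hlo).1 hu
    have hl' := ((hρ.isLeadingMonomial_iff hlo').1 hpuq).symm
    obtain ⟨rfl, rfl⟩ := hρ.eq_of_infix hlo hlo' (infix_of_ofList_eq_mul hl')
    rfl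

end ReductionSystem

open Letter Paren

section Languages

variable {n m : ℕ}

theorem IsDyck.append {u v : List (Paren n)} (hu : IsDyck u) (hv : IsDyck v) :
    IsDyck (u ++ v) := by
  induction hu with
  | nil => exact hv
  | cons i w w' hw hw' _ ih' => simpa using IsDyck.cons i w (w' ++ v) hw ih'

theorem IsDyck.wrap {w : List (Paren n)} (hw : IsDyck w) (i : Fin n) :
    IsDyck (a i :: (w ++ [b i])) :=
  .cons i w [] hw .nil

theorem nil_mem_langP : [] ∈ langP n m := Language.nil_mem_kstar _

theorem cons_mem_langP {w : List (Paren n)} (hw : IsDyck w) {p : List (Letter n m)}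
    (hp : p ∈ langP n m) : w.map br ++ e :: p ∈ langP n m := by
  rw [langP, Language.mem_kstar] at hp ⊢
  obtain ⟨L, rfl, hL⟩ := hp
  refine ⟨(w.map br ++ [e]) :: L, by simp, ?_⟩
  intro u hu
  rcases List.mem_cons.1 hu with rfl | hu
  · exact Language.mem_mul.2 ⟨_, ⟨w, hw, rfl⟩, [e], rfl, rfl⟩
  · exact hL u hu

theorem langP_induction {motive : List (Letter n m) → Prop} (nil : motive [])
    (cons : ∀ w p, IsDyck w → p ∈ langP n m → motive p → motive (w.map br ++ e :: p))
    {p : List (Letter n m)} (hp : p ∈ langP n m) : motive p := by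
  rw [langP, Language.mem_kstar] at hp
  obtain ⟨L, rfl, hL⟩ := hp
  induction L with
  | nil => exact nil
  | cons u L ih =>
    obtain ⟨_, ⟨w, hw, rfl⟩, _, rfl, rfl⟩ := Language.mem_mul.1 (hL u (by simp))
    have hL' : ∀ y ∈ L, y ∈ Language.map br (dyck n) * {[e]} := fun y hy => hL y (by simp [hy])
    have := cons w L.flatten hw (Language.join_mem_kstar hL') (ih hL')
    simpa using this

theorem langP_cases {p : List (Letter n m)} (hp : p ∈ langP n m) :
    p = [] ∨ ∃ w p', IsDyck w ∧ p' ∈ langP n m ∧ p = w.map br ++ e :: p' :=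
  langP_induction (motive := fun p => p = [] ∨ ∃ w p', IsDyck w ∧ p' ∈ langP n m ∧
    p = w.map br ++ e :: p') (Or.inl rfl) (fun w p hw hp _ => Or.inr ⟨w, p, hw, hp, rfl⟩) hp

theorem replicate_append_mem_langP (i : ℕ) {p : List (Letter n m)} (hp : p ∈ langP n m) :
    List.replicate i e ++ p ∈ langP n m := by
  induction i with
  | zero => simpa using hp
  | succ i ih => simpa [List.replicate_succ] using cons_mem_langP IsDyck.nil ih

theorem langP_eq_explicitP : langP n m = explicitP n m := by
  ext u
  constructor
  · refine langP_induction ⟨0, [], by simp, by simp⟩ ?_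
    rintro w _ hw - ⟨i, l, hl, rfl⟩
    refine ⟨0, (w, i + 1) :: l, ?_, by simp [List.replicate_succ]⟩
    intro q hq
    rcases List.mem_cons.1 hq with rfl | hq
    · exact ⟨hw, Nat.succ_pos i⟩
    · exact hl q hq
  · rintro ⟨i, l, hl, rfl⟩
    refine replicate_append_mem_langP i ?_
    induction l with
    | nil => exact nil_mem_langP
    | cons q l ih =>
      obtain ⟨hq, hpos⟩ := hl q (by simp)
      obtain ⟨i, hi⟩ := Nat.exists_eq_succ_of_ne_zero hpos.ne'
      have := cons_mem_langP hq
        (replicate_append_mem_langP i (ih fun q hq => hl q (by simp [hq])))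
      simpa [hi, List.replicate_succ] using this

theorem eq_e_or_eq_br_of_mem_langP {p : List (Letter n m)} (hp : p ∈ langP n m)
    {l : Letter n m} (hl : l ∈ p) : l = e ∨ ∃ c, l = br c := by
  revert hl
  refine langP_induction (motive := fun p => l ∈ p → l = e ∨ ∃ c, l = br c) (by simp) ?_ hp
  rintro w p - - ih hl
  simp only [List.mem_append, List.mem_map, List.mem_cons] at hl
  rcases hl with ⟨c, -, rfl⟩ | rfl | hl
  · exact Or.inr ⟨c, rfl⟩
  · exact Or.inl rfl
  · exact ih hl

theorem x_notMem_of_mem_langP {p : List (Letter n m)} (hp : p ∈ langP n m) : x ∉ p := fun hx => by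
  simpa using eq_e_or_eq_br_of_mem_langP hp hx

theorem y_notMem_of_mem_langP {p : List (Letter n m)} (hp : p ∈ langP n m) : y ∉ p := fun hy => by
  simpa using eq_e_or_eq_br_of_mem_langP hp hy

theorem langP_ne_append_br {p : List (Letter n m)} (hp : p ∈ langP n m) (s : List (Letter n m))
    (c : Paren n) : p ≠ s ++ [br c] := by
  have h : ∀ l ∈ p.getLast?, l = e := by
    refine langP_induction (motive := fun p => ∀ l ∈ p.getLast?, l = e) (by simp) ?_ hp
    intro w p _ _ ih l hl
    rcases eq_or_ne p [] with rfl | hne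
    · simpa using hl.symm
    · apply ih
      obtain ⟨d, p, rfl⟩ := List.exists_cons_of_ne_nil hne
      simpa [List.getLast?_append, List.getLast?_cons_cons] using hl
  rintro rfl
  simpa using h (br c) (by simp)

variable (φ : FreeMonoid (Paren n) →* FreeMonoid (Fin m))

theorem nil_mem_dyckImage : [] ∈ dyckImage φ := ⟨[], IsDyck.nil, by simp⟩

theorem append_mem_dyckImage {w : List (Paren n)} (hw : IsDyck w) {l : List (Fin m)}
    (hl : l ∈ dyckImage φ) : (φ (FreeMonoid.ofList w)).toList ++ l ∈ dyckImage φ := by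
  obtain ⟨w', hw', rfl⟩ := hl
  exact ⟨w ++ w', hw.append hw', by simp [FreeMonoid.ofList_append]⟩

theorem mem_langG_iff {u : List (Letter n m)} : u ∈ langG φ ↔
    ∃ p ∈ langP n m, ∃ l ∈ dyckImage φ, u = x :: p ++ y :: (l.map t ++ [e]) := by
  simp only [langG, Language.mem_mul]
  constructor
  · rintro ⟨_, ⟨_, ⟨_, ⟨_, rfl, p, hp, rfl⟩, _, rfl, rfl⟩, _, ⟨l, hl, rfl⟩, rfl⟩, _, rfl, rfl⟩
    exact ⟨p, hp, l, hl, by simp⟩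
  · rintro ⟨p, hp, l, hl, rfl⟩
    exact ⟨_, ⟨_, ⟨_, ⟨_, rfl, p, hp, rfl⟩, _, rfl, rfl⟩, _, ⟨l, hl, rfl⟩, rfl⟩, _, rfl, by simp⟩

theorem infinite_langG : (langG φ : Set (List (Letter n m))).Infinite := by
  refine Set.infinite_of_injective_forall_mem
    (f := fun i : ℕ => x :: List.replicate i e ++ y :: (([] : List (Fin m)).map t ++ [e])) ?_ ?_
  · intro i j h
    simpa using congrArg List.length h
  · intro i
    refine (mem_langG_iff φ).2 ⟨_, ?_, [], nil_mem_dyckImage φ, rfl⟩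
    simpa using replicate_append_mem_langP i nil_mem_langP

variable {φ}

theorem x_mem_of_mem_langG {u : List (Letter n m)} (hu : u ∈ langG φ) : x ∈ u := by
  obtain ⟨p, -, q, -, rfl⟩ := (mem_langG_iff φ).1 hu
  simp

theorem y_mem_of_mem_langG {u : List (Letter n m)} (hu : u ∈ langG φ) : y ∈ u := by
  obtain ⟨p, -, q, -, rfl⟩ := (mem_langG_iff φ).1 hu
  simp

theorem exists_eq_x_cons_of_mem_langG {u : List (Letter n m)} (hu : u ∈ langG φ) :
    ∃ v, u = x :: v ∧ x ∉ v := by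
  obtain ⟨p, hp, l, -, rfl⟩ := (mem_langG_iff φ).1 hu
  exact ⟨_, List.cons_append .., by simp [x_notMem_of_mem_langP hp]⟩

theorem exists_eq_append_e_of_mem_langG {u : List (Letter n m)} (hu : u ∈ langG φ) :
    ∃ v, u = v ++ [e] := by
  obtain ⟨p, -, l, -, rfl⟩ := (mem_langG_iff φ).1 hu
  exact ⟨x :: p ++ y :: l.map t, by simp⟩

theorem eq_of_infix_of_mem_langG {u v : List (Letter n m)} (hu : u ∈ langG φ) (hv : v ∈ langG φ)
    (h : u <:+: v) : u = v := by
  obtain ⟨s, r, hsr⟩ := h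
  obtain ⟨p, hp, q, -, rfl⟩ := (mem_langG_iff φ).1 hu
  obtain ⟨p', hp', q', -, rfl⟩ := (mem_langG_iff φ).1 hv
  have hx : ([] : List (Letter n m)) ++ x :: (p' ++ y :: (q'.map t ++ [e])) =
      s ++ x :: (p ++ y :: (q.map t ++ [e] ++ r)) := by
    simpa using hsr.symm
  obtain ⟨-, -, hy⟩ :=
    (List.append_cons_inj_of_notMem (by simp) (by simp [x_notMem_of_mem_langP hp'])).1 hx
  obtain ⟨rfl, -, he⟩ := (List.append_cons_inj_of_notMem (y_notMem_of_mem_langP hp') (by simp)).1 hy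
  rw [List.append_assoc] at he
  obtain ⟨hq, -, -⟩ := (List.append_cons_inj_of_notMem (by simp) (by simp)).1 he
  rw [hq]

end Languages

section Rules

variable {n m : ℕ} [NeZero n] (φ : FreeMonoid (Paren n) →* FreeMonoid (Fin m))

/-- The relations (i)–(iii) as rewriting rules. -/
inductive BaseRule : List (Letter n m) → Option (List (Letter n m)) → Prop
  | up_a_x (i : Fin n) : BaseRule [up (a i) i, x] (some [x, up (a i) i])
  | up_b_x : BaseRule [up (b 0) 0, x] (some [x, e])
  | up_br (c c' : Paren n) (j : Fin n) : BaseRule [up c j, br c'] (some [br c, up c' j])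
  | up_e (c : Paren n) (j : Fin n) : BaseRule [up c j, e] (some [br c, br (b j)])
  | br_y (c : Paren n) : BaseRule [br c, y] (some (y :: (φ (FreeMonoid.of c)).toList.map t))
  | up_y (c : Paren n) (j : Fin n) : BaseRule [up c j, y] none

/-- The relations (i)–(iii) as rewriting rules, together with the rules `x P_n y L e → 0`. -/
inductive CompletedRule : List (Letter n m) → Option (List (Letter n m)) → Prop
  | base {l : List (Letter n m)} {o : Option (List (Letter n m))} :
      BaseRule φ l o → CompletedRule l o
  | of_mem_langG {u : List (Letter n m)} : u ∈ langG φ → CompletedRule u none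

theorem binomials_baseRule (k : Type*) [Field k] :
    binomials k (BaseRule φ) = relI k ∪ relII k ∪ relIII k φ := by
  ext f
  constructor
  · rintro ⟨_, _, h, rfl⟩
    cases h with
    | up_a_x i => exact Or.inl (Or.inl (Or.inl ⟨i, rfl⟩))
    | up_b_x => exact Or.inl (Or.inl (Or.inr rfl))
    | up_br c c' j => exact Or.inl (Or.inr (Or.inl ⟨c, c', j, rfl⟩))
    | up_e c j => exact Or.inl (Or.inr (Or.inr ⟨c, j, rfl⟩))
    | br_y c => exact Or.inr (Or.inl ⟨c, rfl⟩)
    | up_y c j => exact Or.inr (Or.inr ⟨c, j, sub_zero _⟩)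
  · rintro (((⟨i, rfl⟩ | rfl) | (⟨c, c', j, rfl⟩ | ⟨c, j, rfl⟩)) | (⟨c, rfl⟩ | ⟨c, j, rfl⟩))
    · exact ⟨_, _, .up_a_x i, rfl⟩
    · exact ⟨_, _, .up_b_x, rfl⟩
    · exact ⟨_, _, .up_br c c' j, rfl⟩
    · exact ⟨_, _, .up_e c j, rfl⟩
    · exact ⟨_, _, .br_y c, rfl⟩
    · exact ⟨_, _, .up_y c j, (sub_zero _).symm⟩

theorem binomials_completedRule (k : Type*) [Field k] :
    binomials k (CompletedRule φ) =
      (relI k ∪ relII k ∪ relIII k φ) ∪ word k '' langG φ := by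
  rw [← binomials_baseRule]
  ext f
  constructor
  · rintro ⟨_, _, h | hu, rfl⟩
    · exact Or.inl ⟨_, _, h, rfl⟩
    · exact Or.inr ⟨_, hu, (sub_zero _).symm⟩
  · rintro (⟨_, _, h, rfl⟩ | ⟨_, hu, rfl⟩)
    · exact ⟨_, _, .base h, rfl⟩
    · exact ⟨_, _, .of_mem_langG hu, (sub_zero _).symm⟩

variable {φ}

theorem BaseRule.left_eq {l : List (Letter n m)} {o : Option (List (Letter n m))}
    (h : BaseRule φ l o) : (∃ c j d, l = [up c j, d]) ∨ ∃ c, l = [br c, y] := by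
  cases h <;> simp

theorem BaseRule.length_left {l : List (Letter n m)} {o : Option (List (Letter n m))}
    (h : BaseRule φ l o) : l.length = 2 := by
  cases h <;> rfl

theorem BaseRule.right_unique {l : List (Letter n m)} {o o' : Option (List (Letter n m))}
    (h : BaseRule φ l o) (h' : BaseRule φ l o') : o = o' := by
  cases h <;> cases h' <;> rfl

theorem BaseRule.not_infix_langG {l u : List (Letter n m)} {o : Option (List (Letter n m))}
    (h : BaseRule φ l o) (hu : u ∈ langG φ) : ¬ l <:+: u := by
  rintro ⟨s, r, hsr⟩
  obtain ⟨p, hp, q, -, rfl⟩ := (mem_langG_iff φ).1 hu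
  rcases h.left_eq with ⟨c, j, d, rfl⟩ | ⟨c, rfl⟩
  · have hup : up c j ∈ x :: p ++ y :: (q.map t ++ [e]) := by simp [← hsr]
    have hp' : up c j ∈ p := by simpa using hup
    simpa using eq_e_or_eq_br_of_mem_langP hp hp'
  · have hsr' : x :: p ++ y :: (q.map t ++ [e]) = (s ++ [br c]) ++ y :: r := by simpa using hsr.symm
    obtain ⟨hxp, -⟩ :=
      (List.append_cons_inj_of_notMem (by simp [y_notMem_of_mem_langP hp]) (by simp)).1 hsr'
    cases s with
    | nil => simp at hxp
    | cons d s => exact langP_ne_append_br hp s c (List.cons.inj hxp).2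

theorem CompletedRule.eq_of_infix {l l' : List (Letter n m)}
    {o o' : Option (List (Letter n m))} (h : CompletedRule φ l o) (h' : CompletedRule φ l' o')
    (hll' : l <:+: l') : l = l' ∧ o = o' := by
  rcases h with h | hu <;> rcases h' with h' | hu'
  · obtain rfl := hll'.eq_of_length (h.length_left.trans h'.length_left.symm)
    exact ⟨rfl, h.right_unique h'⟩
  · exact absurd hll' (h.not_infix_langG hu')
  · have hx := hll'.subset (x_mem_of_mem_langG hu)
    have hy := hll'.subset (y_mem_of_mem_langG hu)
    cases h' <;> simp at hx hy
  · exact ⟨eq_of_infix_of_mem_langG hu hu' hll', rfl⟩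

theorem CompletedRule.not_infix_right {l l' r : List (Letter n m)}
    {o : Option (List (Letter n m))} (h : CompletedRule φ l o)
    (h' : CompletedRule φ l' (some r)) : ¬ l <:+: r := by
  intro hlr
  obtain ⟨h'⟩ := h'
  rcases h with h | hu
  · rcases h.left_eq with ⟨c, j, d, rfl⟩ | ⟨c, rfl⟩
    · have hup := hlr.subset (List.mem_cons_self ..)
      cases h' with
      | up_a_x | up_br => simpa using hlr.eq_of_length rfl
      | _ => simp at hup
    · have hc := hlr.subset (List.mem_cons_self ..)
      have hy := hlr.subset (List.mem_cons_of_mem _ (List.mem_cons_self ..))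
      cases h' <;> simp at hc hy
  · have hx := hlr.subset (x_mem_of_mem_langG hu)
    have hy := hlr.subset (y_mem_of_mem_langG hu)
    cases h' <;> simp at hx hy

theorem disjoint_binomials_baseRule_langG (φ : FreeMonoid (Paren n) →* FreeMonoid (Fin m))
    (k : Type*) [Field k] : Disjoint (binomials k (BaseRule φ)) (word k '' langG φ) := by
  rw [Set.disjoint_left]
  rintro _ ⟨l, o, h, rfl⟩ ⟨u, hu, huf⟩
  have hul : u ≠ l := by
    rintro rfl
    exact h.not_infix_langG hu List.infix_rfl
  have ho : (wordOrZero k o).coeff (FreeMonoid.ofList l) = 1 := by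
    have := congrArg (fun f => f.coeff (FreeMonoid.ofList l)) huf
    simpa [word, hul, sub_eq_zero, eq_comm (a := (0 : k)), eq_comm (a := (1 : k))] using this
  obtain rfl : o = some l := coeff_wordOrZero_ne_zero (ho.trans_ne one_ne_zero)
  exact CompletedRule.not_infix_right (.base h) (.base h) List.infix_rfl

end Rules

section Reductions

variable {n m : ℕ} [NeZero n] {φ : FreeMonoid (Paren n) →* FreeMonoid (Fin m)}

theorem BaseRule.reduces_append {l : List (Letter n m)} {o : Option (List (Letter n m))}
    (h : BaseRule φ l o) (v : List (Letter n m)) :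
    Reduces (BaseRule φ) (some (l ++ v)) (o.map (· ++ v)) := by
  simpa only [List.nil_append] using Reduces.of_rule h [] v

theorem reduces_up_append_e (c : Paren n) (j : Fin n) (w : List (Paren n))
    (v : List (Letter n m)) :
    Reduces (BaseRule φ) (some (up c j :: (w.map br ++ e :: v)))
      (some (br c :: (w.map br ++ br (b j) :: v))) := by
  induction w generalizing c with
  | nil => exact (BaseRule.up_e c j).reduces_append v
  | cons c' w ih =>
    refine ((BaseRule.up_br c c' j).reduces_append _).trans ?_
    simpa using (ih c').map_append [br c] []

theorem reduces_append_y (w : List (Paren n)) (v : List (Letter n m)) :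
    Reduces (BaseRule φ) (some (w.map br ++ y :: v))
      (some (y :: ((φ (FreeMonoid.ofList w)).toList.map t ++ v))) := by
  induction w generalizing v with
  | nil => simpa using Relation.ReflTransGen.refl
  | cons c w ih =>
    have hw : Reduces (BaseRule φ) (some (br c :: (w.map br ++ y :: v)))
        (some (br c :: y :: ((φ (FreeMonoid.ofList w)).toList.map t ++ v))) := by
      simpa using (ih v).map_append [br c] []
    simpa [FreeMonoid.ofList_cons] using hw.trans ((BaseRule.br_y c).reduces_append _)

theorem Reduces.completed {o o' : Option (List (Letter n m))} (h : Reduces (BaseRule φ) o o') :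
    Reduces (CompletedRule φ) o o' :=
  Relation.ReflTransGen.mono (fun _ _ ⟨hr, p, q⟩ => .of_rule (.base hr) p q) _ _ h

theorem reduces_none_of_mem_langG {u : List (Letter n m)} (hu : u ∈ langG φ) :
    Reduces (CompletedRule φ) (some u) none := by
  simpa using Reduces.of_rule (CompletedRule.of_mem_langG hu) [] []

theorem reduces_none_of_isDyck {w : List (Paren n)} (hw : IsDyck w) {p : List (Letter n m)}
    (hp : p ∈ langP n m) {l : List (Fin m)} (hl : l ∈ dyckImage φ) :
    Reduces (CompletedRule φ) (some (x :: (w.map br ++ p ++ y :: (l.map t ++ [e])))) none := by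
  rcases langP_cases hp with rfl | ⟨w', p', hw', hp', rfl⟩
  · have hy := ((reduces_append_y (φ := φ) w (l.map t ++ [e])).map_append [x] []).completed
    refine Relation.ReflTransGen.trans (by simpa using hy) (reduces_none_of_mem_langG ?_)
    exact (mem_langG_iff φ).2 ⟨[], nil_mem_langP, _, append_mem_dyckImage φ hw hl, by simp⟩
  · exact reduces_none_of_mem_langG
      ((mem_langG_iff φ).2 ⟨_, cons_mem_langP (hw.append hw') hp', l, hl, by simp⟩)

theorem reduces_x_up_none (i : Fin n) {p : List (Letter n m)} (hp : p ∈ langP n m)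
    {l : List (Fin m)} (hl : l ∈ dyckImage φ) :
    Reduces (CompletedRule φ) (some (x :: up (a i) i :: (p ++ y :: (l.map t ++ [e])))) none := by
  rcases langP_cases hp with rfl | ⟨w, p', hw, hp', rfl⟩
  · exact Reduces.of_rule (CompletedRule.base (.up_y (a i) i)) [x] (l.map t ++ [e])
  · have he := ((reduces_up_append_e (φ := φ) (a i) i w
      (p' ++ y :: (l.map t ++ [e]))).map_append [x] []).completed
    refine Relation.ReflTransGen.trans (by simpa using he) ?_
    simpa using reduces_none_of_isDyck (hw.wrap i) hp' hl

theorem BaseRule.joinable {c d f : Letter n m} {o o' : Option (List (Letter n m))}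
    (h : BaseRule φ [c, d] o) (h' : BaseRule φ [d, f] o') :
    Relation.Join (Reduces (CompletedRule φ)) (o.map (· ++ [f])) (o'.map ([c] ++ ·)) := by
  cases h with
  | up_br c c' j =>
    obtain - | - | - | - | ⟨c'⟩ := h'
    refine ⟨none, Reduces.of_rule (CompletedRule.base (.up_y c' j)) [br c] [], ?_⟩
    exact Reduces.of_rule (CompletedRule.base (.up_y c j)) [] ((φ (FreeMonoid.of c')).toList.map t)
  | _ => cases h'

theorem BaseRule.reduces_none {c : Letter n m} {v : List (Letter n m)}
    {o : Option (List (Letter n m))} (h : BaseRule φ [c, x] o) (hv : x :: v ∈ langG φ) :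
    Reduces (CompletedRule φ) (o.map (· ++ v)) none := by
  obtain ⟨p, hp, l, hl, hxv⟩ := (mem_langG_iff φ).1 hv
  obtain rfl : v = p ++ y :: (l.map t ++ [e]) := (List.cons.inj hxv).2
  cases h with
  | up_a_x i => exact reduces_x_up_none i hp hl
  | up_b_x =>
    exact reduces_none_of_mem_langG
      ((mem_langG_iff φ).2 ⟨_, cons_mem_langP .nil hp, l, hl, by simp⟩)

theorem BaseRule.eq_singleton_of_append {u v : List (Letter n m)}
    {o : Option (List (Letter n m))} (h : BaseRule φ (u ++ v) o) (hu : u ≠ []) (hv : v ≠ []) :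
    ∃ c d, u = [c] ∧ v = [d] := by
  have hlen := h.length_left
  rw [List.length_append] at hlen
  have := List.length_pos_iff.2 hu
  have := List.length_pos_iff.2 hv
  obtain ⟨c, rfl⟩ := List.length_eq_one_iff.1 (show u.length = 1 by omega)
  obtain ⟨d, rfl⟩ := List.length_eq_one_iff.1 (show v.length = 1 by omega)
  exact ⟨c, d, rfl, rfl⟩

theorem hasJoinableOverlaps_completedRule : HasJoinableOverlaps (CompletedRule φ) := by
  intro u v w o o' hu hv hw h h'
  rcases h with h | huv <;> rcases h' with h' | hvw
  · obtain ⟨c, d, rfl, rfl⟩ := h.eq_singleton_of_append hu hv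
    obtain ⟨-, f, -, rfl⟩ := h'.eq_singleton_of_append hv hw
    exact h.joinable h'
  · obtain ⟨c, d, rfl, rfl⟩ := h.eq_singleton_of_append hu hv
    obtain ⟨v, hv, -⟩ := exists_eq_x_cons_of_mem_langG hvw
    obtain ⟨rfl, rfl⟩ := List.cons.inj hv
    exact ⟨none, h.reduces_none hvw, .refl⟩
  · obtain ⟨d, f, rfl, rfl⟩ := h'.eq_singleton_of_append hv hw
    obtain ⟨v, hv⟩ := exists_eq_append_e_of_mem_langG huv
    obtain ⟨-, rfl⟩ : u = v ∧ d = e := by simpa using hv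
    cases h'
  · obtain ⟨s, hs, -⟩ := exists_eq_x_cons_of_mem_langG hvw
    obtain ⟨r, hr, hxr⟩ := exists_eq_x_cons_of_mem_langG huv
    obtain ⟨c, u, rfl⟩ := List.exists_cons_of_ne_nil hu
    obtain ⟨d, v, rfl⟩ := List.exists_cons_of_ne_nil hv
    obtain rfl := (List.cons.inj hs).1
    obtain rfl := (List.cons.inj hr).2
    simp at hxr

end Reductions

section IdealMembership

variable {n m : ℕ} [NeZero n] {φ : FreeMonoid (Paren n) →* FreeMonoid (Fin m)} {k : Type*}
  [Field k] {I : TwoSidedIdeal (FreeAlg k (Letter n m))}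

theorem word_x_e_mem (hI : binomials k (BaseRule φ) ⊆ (I : Set (FreeAlg k (Letter n m))))
    {v : List (Letter n m)} (hv : word k (x :: v) ∈ I) : word k (x :: e :: v) ∈ I := by
  refine ((BaseRule.up_b_x.reduces_append v).word_mem_iff hI).1 ?_
  exact word_append (k := k) [up (b 0) 0] (x :: v) ▸ I.mul_mem_left _ _ hv

theorem word_x_append_mem_of_isDyck
    (hI : binomials k (BaseRule φ) ⊆ (I : Set (FreeAlg k (Letter n m)))) {w : List (Paren n)}
    (hw : IsDyck w) {v : List (Letter n m)} (hv : word k (x :: v) ∈ I) :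
    word k (x :: (w.map br ++ v)) ∈ I := by
  induction hw generalizing v with
  | nil => exact hv
  | cons i w w' _ _ ih ih' =>
    have hx : word k (x :: (w.map br ++ e :: (w'.map br ++ v))) ∈ I :=
      ih (word_x_e_mem hI (ih' hv))
    have hup : word k (up (a i) i :: x :: (w.map br ++ e :: (w'.map br ++ v))) ∈ I :=
      word_append (k := k) [up (a i) i] _ ▸ I.mul_mem_left _ _ hx
    have hred : Reduces (BaseRule φ)
        (some (up (a i) i :: x :: (w.map br ++ e :: (w'.map br ++ v))))
        (some (x :: ((a i :: w ++ b i :: w').map br ++ v))) := by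
      refine ((BaseRule.up_a_x i).reduces_append _).trans ?_
      simpa using (reduces_up_append_e (a i) i w (w'.map br ++ v)).map_append [x] []
    exact (hred.word_mem_iff hI).1 hup

theorem word_x_append_mem_of_mem_langP
    (hI : binomials k (BaseRule φ) ⊆ (I : Set (FreeAlg k (Letter n m)))) {p : List (Letter n m)}
    (hp : p ∈ langP n m) {v : List (Letter n m)} (hv : word k (x :: v) ∈ I) :
    word k (x :: (p ++ v)) ∈ I := by
  refine langP_induction (motive := fun p => word k (x :: (p ++ v)) ∈ I) hv ?_ hp
  intro w p hw _ ih
  simpa using word_x_append_mem_of_isDyck hI hw (word_x_e_mem hI ih)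

theorem word_mem_of_mem_langG
    (hI : binomials k (BaseRule φ) ⊆ (I : Set (FreeAlg k (Letter n m))))
    (hxye : word k [x, y, e] ∈ I) {u : List (Letter n m)} (hu : u ∈ langG φ) : word k u ∈ I := by
  obtain ⟨p, hp, _, ⟨w, hw, rfl⟩, rfl⟩ := (mem_langG_iff φ).1 hu
  have hword : word k (x :: (p ++ (w.map br ++ [y, e]))) ∈ I :=
    word_x_append_mem_of_mem_langP hI hp (word_x_append_mem_of_isDyck hI hw hxye)
  refine (Reduces.word_mem_iff hI ?_).1 hword
  simpa using (reduces_append_y (φ := φ) w [e]).map_append (x :: p) []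

variable (k φ) in
theorem span_relations_union_langG :
    TwoSidedIdeal.span ((relI k ∪ relII k ∪ relIII k φ) ∪ word k '' langG φ) =
      TwoSidedIdeal.span (relI k ∪ relII k ∪ relIII k φ ∪ relIV k) := by
  apply le_antisymm
  · have hI : binomials k (BaseRule φ) ⊆
        (TwoSidedIdeal.span (relI k ∪ relII k ∪ relIII k φ ∪ relIV k) : Set (FreeAlg k _)) := by
      rw [binomials_baseRule]
      exact Set.subset_union_left.trans TwoSidedIdeal.subset_span
    refine TwoSidedIdeal.span_le.2 (Set.union_subset ?_ ?_)
    · exact Set.subset_union_left.trans TwoSidedIdeal.subset_span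
    · rintro _ ⟨u, hu, rfl⟩
      exact word_mem_of_mem_langG hI (TwoSidedIdeal.subset_span (Or.inr rfl)) hu
  · refine TwoSidedIdeal.span_mono (Set.union_subset_union_right _ ?_)
    rintro _ rfl
    exact ⟨_, (mem_langG_iff φ).2 ⟨[], nil_mem_langP, [], nil_mem_dyckImage φ, rfl⟩, rfl⟩

end IdealMembership

section DegLex

variable {n m D : ℕ}

instance : Finite (Paren n) :=
  .of_surjective (Sum.elim a b) fun
    | a i => ⟨.inl i, rfl⟩
    | b i => ⟨.inr i, rfl⟩

instance : Finite (Letter n m) := by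
  refine Set.finite_univ_iff.1 (Set.Finite.subset (s := Set.range br ∪
    Set.range (fun q : Paren n × Fin n => up q.1 q.2) ∪ Set.range t ∪ {x, e, y}) ?_ ?_)
  · exact Set.toFinite _
  · rintro (_ | _ | _ | _ | _ | _) - <;> simp

theorem wordDeg_mul (u v : FreeMonoid (Letter n m)) :
    wordDeg D (u * v) = wordDeg D u + wordDeg D v := by
  simp [wordDeg]

theorem wordDeg_ofList_cons (l : Letter n m) (u : List (Letter n m)) :
    wordDeg D (FreeMonoid.ofList (l :: u)) = letterDeg D l + wordDeg D (FreeMonoid.ofList u) := by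
  simp [wordDeg]

theorem wordDeg_ofList_map_t (l : List (Fin m)) :
    wordDeg D (FreeMonoid.ofList (l.map t : List (Letter n m))) = l.length := by
  simp [wordDeg, Function.comp_def, letterDeg]

theorem letterDeg_pos (hD : 0 < D) (l : Letter n m) : 0 < letterDeg D l := by
  cases l <;> simp [letterDeg, hD]

theorem length_le_wordDeg (hD : 0 < D) (w : FreeMonoid (Letter n m)) : w.length ≤ wordDeg D w := by
  have := List.length_le_sum_of_one_le (w.toList.map (letterDeg D))
    (List.forall_mem_map.2 fun l _ => letterDeg_pos hD l)
  rwa [List.length_map] at this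

theorem finite_setOf_wordDeg_eq (hD : 0 < D) (d : ℕ) :
    {w : FreeMonoid (Letter n m) | wordDeg D w = d}.Finite :=
  (List.finite_length_le (Letter n m) d).subset fun w hw => (length_le_wordDeg hD w).trans_eq hw

variable [LinearOrder (Letter n m)]

theorem degLex_iff_prodLex (u v : FreeMonoid (Letter n m)) :
    degLex D u v ↔ Prod.Lex (· < ·) (List.Lex (· < ·)) (wordDeg D u, u.toList)
      (wordDeg D v, v.toList) := by
  rw [Prod.lex_def]
  rfl

theorem lex_append_of_wordDeg_eq (hD : 0 < D) {u v : List (Letter n m)}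
    (h : List.Lex (· < ·) u v)
    (hdeg : wordDeg D (FreeMonoid.ofList u) = wordDeg D (FreeMonoid.ofList v))
    (s : List (Letter n m)) : List.Lex (· < ·) (u ++ s) (v ++ s) := by
  induction h with
  | @nil l _ =>
    -- A proper prefix is the one case where appending `s` may break the order: degrees exclude it.
    have := letterDeg_pos hD l
    rw [wordDeg_ofList_cons] at hdeg
    simp only [FreeMonoid.ofList_nil, wordDeg, FreeMonoid.toList_one, List.map_nil,
      List.sum_nil] at hdeg
    omega
  | cons _ ih =>
    rw [wordDeg_ofList_cons, wordDeg_ofList_cons, Nat.add_left_cancel_iff] at hdeg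
    exact .cons (ih hdeg)
  | rel h => exact .rel h

theorem wellFounded_degLex (hD : 0 < D) :
    WellFounded (degLex D : FreeMonoid (Letter n m) → FreeMonoid (Letter n m) → Prop) := by
  have : IsStrictOrder _ (Function.onFun (List.Lex (· < ·))
      (FreeMonoid.toList : FreeMonoid (Letter n m) ≃ List (Letter n m))) :=
    (RelEmbedding.preimage FreeMonoid.toList.toEmbedding
      ((· < ·) : List (Letter n m) → List (Letter n m) → Prop)).isStrictOrder
  have h := WellFounded.prod_lex_of_wellFoundedOn_fiber
    (f := (wordDeg D : FreeMonoid (Letter n m) → ℕ)) (g := FreeMonoid.toList)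
    (rα := (· < ·)) (rβ := List.Lex (· < ·)) (measure _).wf fun d =>
      (finite_setOf_wordDeg_eq hD d).wellFoundedOn
  exact Subrelation.wf (fun {u v} huv => (degLex_iff_prodLex u v).1 huv) h

theorem isMonomialOrder_degLex (hD : 0 < D) :
    IsMonomialOrder (degLex D : FreeMonoid (Letter n m) → FreeMonoid (Letter n m) → Prop) where
  trichotomous u v huv hvu := by
    rcases Nat.lt_trichotomy (wordDeg D u) (wordDeg D v) with h | h | h
    · exact absurd (Or.inl h) huv
    · exact FreeMonoid.toList.injective (Std.Trichotomous.trichotomous (r := List.Lex (· < ·)) _ _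
        (fun hlex => huv (Or.inr ⟨h, hlex⟩)) fun hlex => hvu (Or.inr ⟨h.symm, hlex⟩))
    · exact absurd (Or.inl h) hvu
  wf := wellFounded_degLex hD
  mul_mul p q u v := by
    rintro (hdeg | ⟨hdeg, hlex⟩)
    · left
      simpa only [wordDeg_mul, Nat.add_lt_add_iff_left, Nat.add_lt_add_iff_right] using hdeg
    · refine Or.inr ⟨by simp only [wordDeg_mul, hdeg], ?_⟩
      refine lex_append_of_wordDeg_eq hD (hlex.append_left _ p.toList) ?_ q.toList
      simpa only [FreeMonoid.ofList_append, FreeMonoid.ofList_toList, wordDeg_mul,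
        Nat.add_left_cancel_iff] using hdeg

theorem degLex_cons_of_lt {l l' : Letter n m} {u v : List (Letter n m)}
    (hdeg : wordDeg D (FreeMonoid.ofList (l :: u)) ≤ wordDeg D (FreeMonoid.ofList (l' :: v)))
    (h : l < l') : degLex D (FreeMonoid.ofList (l :: u)) (FreeMonoid.ofList (l' :: v)) :=
  hdeg.lt_or_eq.imp_right fun hdeg => ⟨hdeg, .rel h⟩

end DegLex

section DegLexRules

variable {n m D : ℕ} [NeZero n] {φ : FreeMonoid (Paren n) →* FreeMonoid (Fin m)}
  [LinearOrder (Letter n m)]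

theorem BaseRule.degLex_right (hφ : ∀ c : Paren n, (φ (FreeMonoid.of c)).length ≤ D)
    (hord : ∀ u v : Letter n m, rank u < rank v → u < v) {l r : List (Letter n m)}
    (h : BaseRule φ l (some r)) : degLex D (FreeMonoid.ofList r) (FreeMonoid.ofList l) := by
  cases h with
  | up_a_x i => exact degLex_cons_of_lt le_rfl (hord _ _ (by simp [rank]))
  | up_b_x => exact degLex_cons_of_lt le_rfl (hord _ _ (by simp [rank]))
  | up_br c c' j => exact degLex_cons_of_lt le_rfl (hord _ _ (by cases c <;> simp [rank]))
  | up_e c j => exact degLex_cons_of_lt le_rfl (hord _ _ (by cases c <;> simp [rank]))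
  | br_y c =>
    refine degLex_cons_of_lt ?_ (hord _ _ (by cases c <;> simp [rank]))
    rw [wordDeg_ofList_cons, wordDeg_ofList_map_t]
    exact Nat.add_le_add_left (hφ c) D

theorem isInterreduced_completedRule (hφ : ∀ c : Paren n, (φ (FreeMonoid.of c)).length ≤ D)
    (hord : ∀ u v : Letter n m, rank u < rank v → u < v) :
    IsInterreduced (degLex D) (CompletedRule φ) where
  lt_of_rule := by
    rintro _ _ ⟨h⟩
    exact h.degLex_right hφ hord
  eq_of_infix := CompletedRule.eq_of_infix
  not_infix := CompletedRule.not_infix_right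

end DegLexRules

end GSDyck

end

open GSDyck in
theorem mainTheorem1 (k : Type*) [Field k] (n m : ℕ) [NeZero n]
    (φ : FreeMonoid (Paren n) →* FreeMonoid (Fin m))
    (D : ℕ) (hD : 0 < D) (hφ : ∀ c : Paren n, (φ (FreeMonoid.of c)).length ≤ D)
    [LinearOrder (Letter n m)] (hord : ∀ u v : Letter n m, rank u < rank v → u < v) :
    IsMinimalGSBasis (degLex D)
      ((relI k ∪ relII k ∪ relIII k φ) ∪ word k '' langG φ)
      (TwoSidedIdeal.span (relI k ∪ relII k ∪ relIII k φ ∪ relIV k)) ∧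
    IsReduced (degLex D)
      ((relI k ∪ relII k ∪ relIII k φ) ∪ word k '' langG φ) ∧
    Disjoint (relI k ∪ relII k ∪ relIII k φ) (word k '' langG φ) ∧
    Set.Infinite (word k '' langG φ) ∧
    langP n m = explicitP n m := by
  have : IsMonomialOrder (degLex D : FreeMonoid (Letter n m) → FreeMonoid (Letter n m) → Prop) :=
    isMonomialOrder_degLex hD
  have hρ : IsInterreduced (degLex D) (CompletedRule φ) := isInterreduced_completedRule hφ hord
  refine ⟨?_, ?_, ?_, (infinite_langG φ).image word_injective.injOn, langP_eq_explicitP⟩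
  · rw [← span_relations_union_langG, ← binomials_completedRule]
    exact hρ.isMinimalGSBasis hasJoinableOverlaps_completedRule
  · rw [← binomials_completedRule]
    exact hρ.isReduced
  · rw [← binomials_baseRule]
    exact disjoint_binomials_baseRule_langG φ k
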